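/- Let $n\ge 0$ and let $H$ be any linear subspace of $\mathbb{R}^n$. Let $B_1^n=\{x\in\mathbb{R}^n : \sum_{i=1}^n |x_i|\le 1\}$ be the cross-polytope, and let $\mathrm{vol}_H$ denote Lebesgue measure on $H$ (with respect to the Euclidean structure inherited from $\mathbb{R}^n$). For $t=(t_1,\ldots,t_n)\in\mathbb{R}^n$ put $$f(t)=\mathrm{vol}_H\left(\mathrm{diag}(e^{t_1},\ldots,e^{t_n})B_1^n\cap H\right),$$ where $\mathrm{diag}(e^{t_1},\ldots,e^{t_n})$ is the diagonal matrix with entries $e^{t_i}$. Then $f$ is finite and log-concave on $\mathbb{R}^n$, that is, $f(\lambda s+(1-\lambda)t)\ge f(s)^{\lambda}f(t)^{1-\lambda}$ for all $s,t\in\mathbb{R}^n$ and $\lambda\in[0,1]$. -/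

import Mathlib

open MeasureTheory

/-- A nonnegative function `f` on a real vector space is log-concave if
`f x ^ a * f y ^ b ≤ f (a x + b y)` for all points `x`, `y` and all weights `a, b ≥ 0` with
`a + b = 1`. -/
def IsLogConcave {E : Type*} [AddCommGroup E] [Module ℝ E] (f : E → ℝ) : Prop :=
  (∀ x, 0 ≤ f x) ∧
    ∀ x y : E, ∀ a b : ℝ, 0 ≤ a → 0 ≤ b → a + b = 1 → f x ^ a * f y ^ b ≤ f (a • x + b • y)

/-- The cross-polytope `B_1^n = {x ∈ ℝⁿ : ∑ |x_i| ≤ 1}`. -/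
def crossPolytope (n : ℕ) : Set (EuclideanSpace ℝ (Fin n)) :=
  {x | ∑ i, |x i| ≤ 1}

/-- The dilation `diag(e^{t_1}, …, e^{t_n}) K` of a set `K ⊆ ℝⁿ`. -/
noncomputable def expDilation {n : ℕ} (t : Fin n → ℝ) (K : Set (EuclideanSpace ℝ (Fin n))) :
    Set (EuclideanSpace ℝ (Fin n)) :=
  Matrix.toEuclideanLin (Matrix.diagonal fun i => Real.exp (t i)) '' K

/-- Lebesgue measure on the subspace `H` of `ℝⁿ`, regarded as a measure on `ℝⁿ` supported on `H`.
The measure on the type `H` is the Lebesgue measure of the Euclidean space `H`, with the inner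
product inherited from `ℝⁿ`. The instance is named explicitly to exclude the instance for subtypes
that restricts the ambient `n`-dimensional Lebesgue measure, which vanishes on proper subspaces. -/
noncomputable def subspaceVolume {n : ℕ} (H : Submodule ℝ (EuclideanSpace ℝ (Fin n))) :
    Measure (EuclideanSpace ℝ (Fin n)) :=
  Measure.map (Subtype.val : H → EuclideanSpace ℝ (Fin n))
    (@volume H measureSpaceOfInnerProductSpace)

/-! For a norm `g` on a `k`-dimensional space, `∫ exp (-g) = k! · vol {g ≤ 1}`, so it suffices to
treat `∫_H exp (-∑ e^{-t_i} |x_i|)`. Each factor `exp (-|z|)` is a mixture over `v` of Gaussians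
`exp (-e^{-2v} z² / 2)` with weight `exp (v - e^{2v} / 2)`, log-concave in `v`
(`lintegral_exp_sub_mul_exp_neg_sq`). By Tonelli the integral becomes one over `y ∈ ℝⁿ` of a
log-concave weight times a Gaussian integral on `H`. The latter is a constant times `det (Vᵀ D V) ^
(-1/2)`, with `D` the diagonal matrix of entries `e^{-2(y_i + t_i)} / 2`. By Cauchy-Binet this
determinant is a nonnegative combination of exponentials of affine forms in `y + t`, hence
log-convex (`Matrix.det_transpose_mul_diagonal_exp_mul_le`). The integrand is thus jointly
log-concave in `(y, t)`, and Prékopa-Leindler (`lintegral_pi_rpow_mul_le`) passes this to its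
marginal in `t`. -/

/-! ### Brunn-Minkowski on the line and Prékopa-Leindler. -/

open Set Pointwise ENNReal in
theorem IsCompact.volume_add_volume_le_volume_add {K L : Set ℝ} (hK : IsCompact K)
    (hL : IsCompact L) (hK' : K.Nonempty) (hL' : L.Nonempty) :
    volume K + volume L ≤ volume (K + L) := by
  have hk := hK.sSup_mem hK'
  have hl := hL.sInf_mem hL'
  set k := sSup K
  set l := sInf L
  -- The translates `K + min L` and `max K + L` lie in `K + L` and meet only at `max K + min L`, so
  -- their measures add.
  have h1 : volume ((fun x => x + l) '' K) = volume K := by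
    simp
  have h2 : volume ((fun x => k + x) '' L) = volume L := by
    simp
  rw [← h1, ← h2, ← measure_union₀]
  · apply measure_mono
    rintro _ (⟨x, hx, rfl⟩ | ⟨x, hx, rfl⟩)
    · exact add_mem_add hx hl
    · exact add_mem_add hk hx
  · exact (hL.image (by fun_prop)).measurableSet.nullMeasurableSet
  · refine measure_mono_null (t := {k + l}) ?_ (by simp)
    rintro _ ⟨⟨x, hx, rfl⟩, ⟨y, hy, h⟩⟩
    have hx' := le_csSup hK.bddAbove hx
    have hy' := csInf_le hL.bddBelow hy
    simp only at h
    simp only [mem_singleton_iff]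
    change x ≤ k at hx'
    change l ≤ y at hy'
    linarith

open Set Pointwise ENNReal in
/-- The one-dimensional Brunn-Minkowski inequality. -/
theorem volume_add_volume_le_volume_add {A B : Set ℝ} (hA : MeasurableSet A)
    (hB : MeasurableSet B) (hA' : A.Nonempty) (hB' : B.Nonempty) :
    volume A + volume B ≤ volume (A + B) := by
  obtain ⟨x, hx⟩ := hA'
  obtain ⟨y, hy⟩ := hB'
  rw [hA.measure_eq_iSup_isCompact, hB.measure_eq_iSup_isCompact]
  simp only [iSup_and']
  refine ENNReal.biSup_add_biSup_le' ⟨∅, by simp⟩ ⟨∅, by simp⟩ fun K hK L hL => ?_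
  -- The approximating compacts may be empty; adjoining a point makes the compact case applicable.
  calc volume K + volume L ≤ volume (insert x K) + volume (insert y L) := by
        gcongr <;> exact subset_insert _ _
    _ ≤ volume (insert x K + insert y L) :=
        (hK.2.insert x).volume_add_volume_le_volume_add (hL.2.insert y) (insert_nonempty _ _)
          (insert_nonempty _ _)
    _ ≤ volume (A + B) := measure_mono
        (add_subset_add (insert_subset hx hK.1) (insert_subset hy hL.1))

open Set in
theorem lintegral_eq_lintegral_Ioo_meas_lt_of_le_one {f : ℝ → ENNReal} (hf : Measurable f)
    (hf1 : ∀ x, f x ≤ 1) :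
    ∫⁻ x, f x = ∫⁻ s in Ioo (0 : ℝ) 1, volume {x | ENNReal.ofReal s < f x} := by
  have hfin : ∀ x, f x ≠ ⊤ := fun x => ne_top_of_le_ne_top ENNReal.one_ne_top (hf1 x)
  have h := lintegral_eq_lintegral_meas_lt volume (f := fun x => (f x).toReal)
    (Filter.Eventually.of_forall fun x => ENNReal.toReal_nonneg) hf.ennreal_toReal.aemeasurable
  simp only [ENNReal.ofReal_toReal (hfin _)] at h
  rw [h, ← lintegral_indicator measurableSet_Ioi, ← lintegral_indicator measurableSet_Ioo]
  congr 1
  funext s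
  by_cases hs : 0 < s
  · have e : {x | s < (f x).toReal} = {x | ENNReal.ofReal s < f x} := by
      ext x
      exact (ENNReal.ofReal_lt_iff_lt_toReal hs.le (hfin x)).symm
    by_cases hs1 : s < 1
    · rw [indicator_of_mem (by exact hs), indicator_of_mem (by exact ⟨hs, hs1⟩), e]
    · rw [indicator_of_mem (by exact hs), indicator_of_notMem (by simp [hs1]), e]
      convert measure_empty (μ := (volume : Measure ℝ))
      ext x
      simp only [mem_ofPred_eq, mem_empty_iff_false, iff_false, not_lt]
      exact (hf1 x).trans (ENNReal.one_le_ofReal.2 (not_lt.1 hs1))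
  · rw [indicator_of_notMem (by simpa using hs), indicator_of_notMem (by simp [hs])]

theorem measurable_measure_setOf_ofReal_lt (f : ℝ → ENNReal) :
    Measurable fun s : ℝ => volume {x | ENNReal.ofReal s < f x} := by
  refine Antitone.measurable fun s t hst => measure_mono fun x hx => ?_
  exact lt_of_le_of_lt (ENNReal.ofReal_le_ofReal hst) hx

-- With both suprema equal to 1, all superlevel sets at levels in `(0, 1)` are nonempty, so
-- Brunn-Minkowski applies level by level and the layer-cake formula integrates the result.
open Set Pointwise in
theorem mul_lintegral_add_mul_lintegral_le_of_iSup_eq_one {f g h : ℝ → ENNReal}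
    (hf : Measurable f) (hg : Measurable g) (hh : Measurable h) (hf1 : ⨆ x, f x = 1)
    (hg1 : ⨆ x, g x = 1) {a b : ℝ} (ha : 0 < a) (hb : 0 < b) (hab : a + b = 1)
    (H : ∀ x y, f x ^ a * g y ^ b ≤ h (a * x + b * y)) :
    ENNReal.ofReal a * (∫⁻ x, f x) + ENNReal.ofReal b * (∫⁻ x, g x) ≤ ∫⁻ x, h x := by
  have hfle : ∀ x, f x ≤ 1 := fun x => hf1 ▸ le_iSup f x
  have hgle : ∀ x, g x ≤ 1 := fun x => hg1 ▸ le_iSup g x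
  calc ENNReal.ofReal a * (∫⁻ x, f x) + ENNReal.ofReal b * (∫⁻ x, g x)
      = ∫⁻ s in Ioo (0 : ℝ) 1, (ENNReal.ofReal a * volume {x | ENNReal.ofReal s < f x} +
          ENNReal.ofReal b * volume {x | ENNReal.ofReal s < g x}) := by
        rw [lintegral_add_left ((measurable_measure_setOf_ofReal_lt f).const_mul _),
          lintegral_const_mul _ (measurable_measure_setOf_ofReal_lt f),
          lintegral_const_mul _ (measurable_measure_setOf_ofReal_lt g),
          lintegral_eq_lintegral_Ioo_meas_lt_of_le_one hf hfle,
          lintegral_eq_lintegral_Ioo_meas_lt_of_le_one hg hgle]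
    _ ≤ ∫⁻ s in Ioo (0 : ℝ) 1, volume {x | ENNReal.ofReal s < min (h x) 1} := by
        refine setLIntegral_mono' measurableSet_Ioo fun s hs => ?_
        have hs1 : ENNReal.ofReal s < 1 := by simpa using hs.2
        have hfne : Set.Nonempty {x | ENNReal.ofReal s < f x} := by
          obtain ⟨x, hx⟩ := lt_iSup_iff.1 (hf1.symm ▸ hs1)
          exact ⟨x, hx⟩
        have hgne : Set.Nonempty {x | ENNReal.ofReal s < g x} := by
          obtain ⟨x, hx⟩ := lt_iSup_iff.1 (hg1.symm ▸ hs1)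
          exact ⟨x, hx⟩
        have e1 := Measure.addHaar_smul_of_nonneg volume ha.le {x | ENNReal.ofReal s < f x}
        have e2 := Measure.addHaar_smul_of_nonneg volume hb.le {x | ENNReal.ofReal s < g x}
        simp only [Module.finrank_self, pow_one] at e1 e2
        rw [← e1, ← e2]
        refine (volume_add_volume_le_volume_add ?_ ?_ ?_ ?_).trans (measure_mono ?_)
        · exact (measurableSet_lt measurable_const hf).const_smul₀ a
        · exact (measurableSet_lt measurable_const hg).const_smul₀ b
        · exact hfne.smul_set
        · exact hgne.smul_set
        · rintro _ ⟨_, ⟨x, hx, rfl⟩, _, ⟨y, hy, rfl⟩, rfl⟩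
          refine lt_min (lt_of_lt_of_le ?_ (H x y)) hs1
          have hs0 : ENNReal.ofReal s ≠ 0 := by simpa using hs.1
          calc ENNReal.ofReal s = ENNReal.ofReal s ^ a * ENNReal.ofReal s ^ b := by
                rw [← ENNReal.rpow_add _ _ hs0 ENNReal.ofReal_ne_top, hab, ENNReal.rpow_one]
            _ < f x ^ a * g y ^ b := ENNReal.mul_lt_mul
                (ENNReal.rpow_lt_rpow hx ha) (ENNReal.rpow_lt_rpow hy hb)
    _ = ∫⁻ x, min (h x) 1 :=
        (lintegral_eq_lintegral_Ioo_meas_lt_of_le_one (hh.min measurable_const)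
          fun x => min_le_right _ _).symm
    _ ≤ ∫⁻ x, h x := lintegral_mono fun x => min_le_left _ _

theorem ENNReal.rpow_mul_rpow_le_add (x y : ENNReal) {a b : ℝ} (ha : 0 < a) (hb : 0 < b)
    (hab : a + b = 1) : x ^ a * y ^ b ≤ ENNReal.ofReal a * x + ENNReal.ofReal b * y := by
  have hpq : (1 / a).HolderConjugate (1 / b) := by
    rw [Real.holderConjugate_iff]
    refine ⟨?_, by simpa using hab⟩
    rw [lt_div_iff₀ ha]; linarith
  have := ENNReal.young_inequality (x ^ a) (y ^ b) hpq
  rw [← ENNReal.rpow_mul, ← ENNReal.rpow_mul, mul_one_div_cancel ha.ne',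
    mul_one_div_cancel hb.ne', ENNReal.rpow_one, ENNReal.rpow_one] at this
  simpa [div_eq_mul_inv, ENNReal.ofReal_inv_of_pos, ha, hb, mul_comm] using this

/-- Dividing by the suprema reduces to the normalised case; weighted AM-GM then turns the sum into a
product, and the factor `C = A ^ a * B ^ b` cancels. -/
theorem lintegral_rpow_mul_le_of_bounded {f g h : ℝ → ENNReal} (hf : Measurable f)
    (hg : Measurable g) (hh : Measurable h) {a b : ℝ} (ha : 0 < a) (hb : 0 < b) (hab : a + b = 1)
    (hfb : ⨆ x, f x ≠ ⊤) (hgb : ⨆ x, g x ≠ ⊤)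
    (H : ∀ x y, f x ^ a * g y ^ b ≤ h (a * x + b * y)) :
    (∫⁻ x, f x) ^ a * (∫⁻ x, g x) ^ b ≤ ∫⁻ x, h x := by
  by_cases hA : ⨆ x, f x = 0
  · simp [ENNReal.iSup_eq_zero.1 hA, ha]
  by_cases hB : ⨆ x, g x = 0
  · simp [ENNReal.iSup_eq_zero.1 hB, hb]
  set A := ⨆ x, f x with hAdef
  set B := ⨆ x, g x with hBdef
  set C := A ^ a * B ^ b with hC
  have hA' : A ^ a ≠ 0 := by simp [hA, ha.le, ha]
  have hB' : B ^ b ≠ 0 := by simp [hB, hb.le, hb]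
  have hAt : A ^ a ≠ ⊤ := ENNReal.rpow_ne_top_of_nonneg ha.le hfb
  have hBt : B ^ b ≠ ⊤ := ENNReal.rpow_ne_top_of_nonneg hb.le hgb
  have hC0 : C ≠ 0 := mul_ne_zero hA' hB'
  have hCt : C ≠ ⊤ := ENNReal.mul_ne_top hAt hBt
  have key := mul_lintegral_add_mul_lintegral_le_of_iSup_eq_one (f := fun x => A⁻¹ * f x)
    (g := fun x => B⁻¹ * g x) (h := fun x => C⁻¹ * h x) (hf.const_mul _) (hg.const_mul _)
    (hh.const_mul _) (by rw [← ENNReal.mul_iSup, ENNReal.inv_mul_cancel hA hfb])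
    (by rw [← ENNReal.mul_iSup, ENNReal.inv_mul_cancel hB hgb]) ha hb hab (fun x y => by
      rw [ENNReal.mul_rpow_of_nonneg _ _ ha.le, ENNReal.mul_rpow_of_nonneg _ _ hb.le,
        ENNReal.inv_rpow, ENNReal.inv_rpow, mul_mul_mul_comm,
        ← ENNReal.mul_inv (Or.inl hA') (Or.inl hAt)]
      gcongr
      exact H x y)
  rw [lintegral_const_mul _ hf, lintegral_const_mul _ hg, lintegral_const_mul _ hh] at key
  have := (ENNReal.rpow_mul_rpow_le_add _ _ ha hb hab).trans key
  rw [ENNReal.mul_rpow_of_nonneg _ _ ha.le, ENNReal.mul_rpow_of_nonneg _ _ hb.le,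
        ENNReal.inv_rpow, ENNReal.inv_rpow, mul_mul_mul_comm,
        ← ENNReal.mul_inv (Or.inl hA') (Or.inl hAt)] at this
  rwa [ENNReal.mul_le_mul_iff_right (ENNReal.inv_ne_zero.2 hCt) (ENNReal.inv_ne_top.2 hC0)] at this

theorem lintegral_eq_iSup_lintegral_min_natCast {f : ℝ → ENNReal} (hf : Measurable f) :
    ∫⁻ x, f x = ⨆ n : ℕ, ∫⁻ x, min (f x) n := by
  rw [← lintegral_iSup (fun n => hf.min measurable_const)
    (fun m n hmn x => min_le_min le_rfl (by exact_mod_cast hmn))]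
  congr 1
  funext x
  exact ((inf_iSup_eq (f x) _).symm.trans (by rw [ENNReal.iSup_natCast, inf_top_eq])).symm

/-- The one-dimensional Prékopa-Leindler inequality. -/
theorem lintegral_rpow_mul_le {f g h : ℝ → ENNReal} (hf : Measurable f)
    (hg : Measurable g) (hh : Measurable h) {a b : ℝ} (ha : 0 < a) (hb : 0 < b) (hab : a + b = 1)
    (H : ∀ x y, f x ^ a * g y ^ b ≤ h (a * x + b * y)) :
    (∫⁻ x, f x) ^ a * (∫⁻ x, g x) ^ b ≤ ∫⁻ x, h x := by
  -- Truncation at integer heights and monotone convergence remove the boundedness assumption.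
  rw [lintegral_eq_iSup_lintegral_min_natCast hf, lintegral_eq_iSup_lintegral_min_natCast hg]
  have pow_iSup : ∀ (u : ℕ → ENNReal) {c : ℝ}, 0 < c → (⨆ n, u n) ^ c = ⨆ n, u n ^ c :=
    fun u c hc => (ENNReal.orderIsoRpow c hc).map_iSup u
  rw [pow_iSup _ ha, pow_iSup _ hb]
  simp only [ENNReal.iSup_mul, ENNReal.mul_iSup]
  refine iSup_le fun m => iSup_le fun n => ?_
  refine lintegral_rpow_mul_le_of_bounded (hf.min measurable_const) (hg.min measurable_const) hh
    ha hb hab ?_ ?_ fun x y => le_trans ?_ (H x y)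
  · exact ne_top_of_le_ne_top (ENNReal.natCast_ne_top _) (iSup_le fun x => min_le_right _ _)
  · exact ne_top_of_le_ne_top (ENNReal.natCast_ne_top _) (iSup_le fun x => min_le_right _ _)
  · gcongr <;> exact min_le_left _ _

/-- The Prékopa-Leindler inequality for iterated integrals. -/
theorem lmarginal_rpow_mul_le {ι : Type*} [DecidableEq ι] {f g h : (ι → ℝ) → ENNReal}
    (hf : Measurable f) (hg : Measurable g) (hh : Measurable h) {a b : ℝ} (ha : 0 < a)
    (hb : 0 < b) (hab : a + b = 1) (H : ∀ x y, f x ^ a * g y ^ b ≤ h (a • x + b • y))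
    (s : Finset ι) (x y : ι → ℝ) :
    lmarginal (fun _ => volume) s f x ^ a * lmarginal (fun _ => volume) s g y ^ b ≤
      lmarginal (fun _ => volume) s h (a • x + b • y) := by
  induction s using Finset.induction generalizing x y with
  | empty => simpa using H x y
  | insert i s hi ih =>
    rw [lmarginal_insert f hf hi, lmarginal_insert g hg hi, lmarginal_insert h hh hi]
    -- The induction hypothesis at the updated points is the pointwise hypothesis for the
    -- one-dimensional inequality in coordinate `i`.
    refine lintegral_rpow_mul_le ?_ ?_ ?_ ha hb hab fun u v => ?_
    · exact (hf.lmarginal _).comp (measurable_update _)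
    · exact (hg.lmarginal _).comp (measurable_update _)
    · exact (hh.lmarginal _).comp (measurable_update _)
    · refine (ih _ _).trans_eq ?_
      congr 1
      ext j
      by_cases hj : j = i
      · subst hj; simp
      · simp [hj]

/-- The Prékopa-Leindler inequality. -/
theorem lintegral_pi_rpow_mul_le {ι : Type*} [Fintype ι] {f g h : (ι → ℝ) → ENNReal}
    (hf : Measurable f) (hg : Measurable g) (hh : Measurable h) {a b : ℝ} (ha : 0 < a)
    (hb : 0 < b) (hab : a + b = 1) (H : ∀ x y, f x ^ a * g y ^ b ≤ h (a • x + b • y)) :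
    (∫⁻ x, f x) ^ a * (∫⁻ x, g x) ^ b ≤ ∫⁻ x, h x := by
  classical
  simpa [volume_pi] using lmarginal_rpow_mul_le hf hg hh ha hb hab H Finset.univ 0 0

/-! ### The Laplace density as a Gaussian mixture. -/

theorem lintegral_comp_mul_of_bijective {φ φ' : ℝ → ℝ} (hφ : ∀ x, HasDerivAt φ (φ' x) x)
    (hbij : Function.Bijective φ) (hpos : ∀ x, 0 ≤ φ' x) (u : ℝ → ENNReal) :
    ∫⁻ x, ENNReal.ofReal (φ' x) * u (φ x) = ∫⁻ x, u x := by
  have := lintegral_image_eq_lintegral_abs_deriv_mul (s := Set.univ) MeasurableSet.univ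
    (fun x _ => (hφ x).hasDerivWithinAt) hbij.injective.injOn u
  rw [Set.image_univ, hbij.surjective.range_eq, Measure.restrict_univ] at this
  rw [this]
  simp only [abs_of_nonneg (hpos _)]

theorem lintegral_exp_neg_mul_sq {b : ℝ} (hb : 0 < b) :
    ∫⁻ x : ℝ, ENNReal.ofReal (Real.exp (-b * x ^ 2)) = ENNReal.ofReal √(Real.pi / b) := by
  rw [← integral_gaussian, ofReal_integral_eq_lintegral_ofReal (integrable_exp_neg_mul_sq hb)]
  exact Filter.Eventually.of_forall fun x => (Real.exp_pos _).le

/-- Averaging with `v ↦ -v` replaces `exp v` by `cosh v`. Since `cosh (2v) = 1 + 2 sinh² v`, the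
substitution `x = sinh v` leaves a Gaussian integral. -/
theorem lintegral_exp_mul_exp_neg_mul_cosh {z : ℝ} (hz : 0 < z) :
    ∫⁻ v : ℝ, ENNReal.ofReal (Real.exp v * Real.exp (-(z * Real.cosh (2 * v)))) =
      ENNReal.ofReal (Real.exp (-z) * √(Real.pi / (2 * z))) := by
  set I := ∫⁻ v : ℝ, ENNReal.ofReal (Real.exp v * Real.exp (-(z * Real.cosh (2 * v)))) with hI
  have hmeas : Measurable fun v : ℝ =>
      ENNReal.ofReal (Real.exp v * Real.exp (-(z * Real.cosh (2 * v)))) := by fun_prop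
  have hneg : I = ∫⁻ v : ℝ, ENNReal.ofReal (Real.exp (-v) * Real.exp (-(z * Real.cosh (2 * v)))) := by
    rw [hI, ← lintegral_neg_eq_self]
    simp
  have h2 : 2 * I = 2 * ENNReal.ofReal (Real.exp (-z) * √(Real.pi / (2 * z))) := by
    calc 2 * I = I + I := two_mul I
      _ = ∫⁻ v : ℝ, 2 * ENNReal.ofReal (Real.exp (-z)) * (ENNReal.ofReal (Real.cosh v) *
            ENNReal.ofReal (Real.exp (-(2 * z) * Real.sinh v ^ 2))) := by
          nth_rewrite 2 [hneg]
          rw [hI, ← lintegral_add_left hmeas]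
          congr 1
          funext v
          rw [← ENNReal.ofReal_add (by positivity) (by positivity),
            ← ENNReal.ofReal_mul (Real.cosh_pos v).le,
            show (2 : ENNReal) = ENNReal.ofReal 2 by simp, ← ENNReal.ofReal_mul (by norm_num),
            ← ENNReal.ofReal_mul (by positivity)]
          congr 1
          have e : Real.exp (-(z * Real.cosh (2 * v))) =
              Real.exp (-z) * Real.exp (-(2 * z) * Real.sinh v ^ 2) := by
            rw [← Real.exp_add, Real.cosh_two_mul, Real.cosh_sq]
            congr 1; ring
          rw [e, Real.cosh_eq]
          ring
      _ = 2 * ENNReal.ofReal (Real.exp (-z) * √(Real.pi / (2 * z))) := by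
          rw [lintegral_const_mul _ (by fun_prop), lintegral_comp_mul_of_bijective
            (u := fun x => ENNReal.ofReal (Real.exp (-(2 * z) * x ^ 2)))
            Real.hasDerivAt_sinh Real.sinh_bijective (fun x => (Real.cosh_pos x).le),
            lintegral_exp_neg_mul_sq (by positivity), ENNReal.ofReal_mul (Real.exp_pos _).le,
            mul_assoc]
  rwa [ENNReal.mul_right_inj (by simp) (by simp)] at h2

/-- The case `z = 0` of the mixture formula: `x = exp v` gives a Gaussian on the half-line. -/
theorem lintegral_exp_mul_exp_neg_exp :
    ∫⁻ v : ℝ, ENNReal.ofReal (Real.exp v * Real.exp (-(Real.exp (2 * v) / 2))) =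
      ENNReal.ofReal √(Real.pi / 2) := by
  have := lintegral_image_eq_lintegral_abs_deriv_mul (s := Set.univ) MeasurableSet.univ
    (fun x _ => (Real.hasDerivAt_exp x).hasDerivWithinAt) Real.exp_injective.injOn
    (fun x => ENNReal.ofReal (Real.exp (-(1 / 2) * x ^ 2)))
  rw [Set.image_univ, Real.range_exp, Measure.restrict_univ,
    ← ofReal_integral_eq_lintegral_ofReal (integrable_exp_neg_mul_sq (by norm_num)).integrableOn
      (Filter.Eventually.of_forall fun x => (Real.exp_pos _).le), integral_gaussian_Ioi] at this
  have e : √(Real.pi / 2) = √(Real.pi / (1 / 2)) / 2 := by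
    rw [eq_div_iff two_ne_zero, show Real.pi / (1 / 2) = Real.pi / 2 * 2 ^ 2 by ring,
      Real.sqrt_mul (by positivity), Real.sqrt_sq (by norm_num)]
  rw [e, this]
  congr 1
  funext v
  rw [abs_of_pos (Real.exp_pos v), ← ENNReal.ofReal_mul (Real.exp_pos v).le, ← Real.exp_nat_mul]
  congr 3
  push_cast
  ring

/-- The function `e ^ (-|z|)` is a mixture of centered Gaussians. -/
theorem lintegral_exp_sub_mul_exp_neg_sq (z : ℝ) :
    ∫⁻ v : ℝ, ENNReal.ofReal (Real.exp (v - Real.exp (2 * v) / 2)) *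
      ENNReal.ofReal (Real.exp (-(Real.exp (-(2 * v)) / 2 * z ^ 2))) =
      ENNReal.ofReal √(Real.pi / 2) * ENNReal.ofReal (Real.exp (-|z|)) := by
  wlog hz : 0 ≤ z generalizing z
  · simpa using this (-z) (by linarith)
  rw [abs_of_nonneg hz, ← ENNReal.ofReal_mul (by positivity)]
  rcases hz.eq_or_lt with rfl | hz
  · simpa [sub_eq_add_neg, Real.exp_add] using lintegral_exp_mul_exp_neg_exp
  -- This shift balances the terms `e^{2v} / 2` and `e^{-2v} z² / 2`, whose sum becomes `z cosh
  -- (2v)`.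
  rw [← lintegral_add_right_eq_self _ (Real.log z / 2)]
  have e : ∀ v : ℝ, ENNReal.ofReal (Real.exp (v + Real.log z / 2 -
        Real.exp (2 * (v + Real.log z / 2)) / 2)) *
      ENNReal.ofReal (Real.exp (-(Real.exp (-(2 * (v + Real.log z / 2))) / 2 * z ^ 2))) =
      ENNReal.ofReal √z *
        ENNReal.ofReal (Real.exp v * Real.exp (-(z * Real.cosh (2 * v)))) := by
    intro v
    have h1 : Real.exp (2 * (v + Real.log z / 2)) = z * Real.exp (2 * v) := by
      rw [mul_add, mul_div_cancel₀ _ two_ne_zero, Real.exp_add, Real.exp_log hz, mul_comm]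
    have h2 : Real.exp (-(2 * (v + Real.log z / 2))) = z⁻¹ * Real.exp (-(2 * v)) := by
      rw [Real.exp_neg, h1, Real.exp_neg, mul_inv]
    have h3 : √z = Real.exp (Real.log z / 2) := by
      rw [Real.exp_half, Real.exp_log hz]
    rw [h1, h2, h3, ← ENNReal.ofReal_mul (Real.exp_pos _).le,
      ← ENNReal.ofReal_mul (Real.exp_pos _).le, ← Real.exp_add, ← Real.exp_add, ← Real.exp_add,
      Real.cosh_eq]
    congr 2
    field_simp
    ring
  simp only [e]
  rw [lintegral_const_mul _ (by fun_prop), lintegral_exp_mul_exp_neg_mul_cosh hz,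
    ← ENNReal.ofReal_mul (by positivity)]
  congr 1
  rw [mul_left_comm, ← Real.sqrt_mul hz.le, mul_comm]
  congr 2
  field_simp

theorem lintegral_pi_prod_eq_prod {ι : Type*} [Fintype ι] {φ : ι → ℝ → ENNReal}
    (hφ : ∀ i, Measurable (φ i)) :
    ∫⁻ x : ι → ℝ, ∏ i, φ i (x i) = ∏ i, ∫⁻ x, φ i x := by
  classical
  suffices h : ∀ (s : Finset ι) (x : ι → ℝ), lmarginal (fun _ => volume) s
      (fun x : ι → ℝ => ∏ i ∈ s, φ i (x i)) x = ∏ i ∈ s, ∫⁻ x, φ i x by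
    simpa [volume_pi] using h Finset.univ 0
  intro s
  induction s using Finset.induction with
  | empty => simp
  | insert i s hi ih =>
    intro x
    have hm : ∀ t : Finset ι, Measurable fun x : ι → ℝ => ∏ i ∈ t, φ i (x i) := fun t =>
      Finset.measurable_fun_prod _ fun i _ => (hφ i).comp (measurable_pi_apply i)
    rw [lmarginal_insert' _ (hm _) hi, Finset.prod_insert hi]
    have e : (fun x : ι → ℝ => ∫⁻ y, ∏ j ∈ insert i s, φ j (Function.update x i y j)) =
        fun x => (∫⁻ y, φ i y) * ∏ j ∈ s, φ j (x j) := by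
      funext x
      rw [← lintegral_mul_const _ (hφ i)]
      congr 1
      funext y
      rw [Finset.prod_insert hi, Function.update_self]
      congr 1
      refine Finset.prod_congr rfl fun j hj => ?_
      rw [Function.update_of_ne (by rintro rfl; exact hi hj)]
    rw [e, ← ih x]
    exact lintegral_const_mul _ ((hm s).comp measurable_updateFinset)

/-! ### Cauchy-Binet and log-convexity of determinants. -/

open Matrix Finset in
/-- A form of the Cauchy-Binet formula. -/
theorem Matrix.factorial_mul_det_transpose_mul_diagonal_mul {m k : Type*} [Fintype m] [DecidableEq m]
    [Fintype k] [DecidableEq k] (V : Matrix m k ℝ) (w : m → ℝ) :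
    (Fintype.card k).factorial * (Vᵀ * diagonal w * V).det =
      ∑ p : k → m, (∏ j, w (p j)) * (V.submatrix p id).det ^ 2 := by
  -- The sum runs over all maps `p`, not over subsets of rows: non-injective maps contribute zero
  -- and each subset is counted `(card k)!` times.
  have h1 : (Vᵀ * diagonal w * V).det =
      ∑ p : k → m, (∏ j, w (p j) * V (p j) j) * (V.submatrix p id).det := by
    have hdet : ∀ p : k → m, (V.submatrix p id).det =
        ∑ σ : Equiv.Perm k, ((Equiv.Perm.sign σ : ℤ) : ℝ) * ∏ j, V (p j) (σ j) := by
      intro p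
      rw [← det_transpose, det_apply']
      rfl
    have hent : ∀ i j, (Vᵀ * diagonal w * V) i j = ∑ x, V x i * w x * V x j := by
      intro i j
      rw [mul_apply]
      simp only [mul_diagonal, transpose_apply]
    simp only [hdet, det_apply', hent, prod_univ_sum,
      Fintype.piFinset_univ, mul_sum]
    rw [sum_comm]
    refine sum_congr rfl fun p _ => sum_congr rfl fun σ _ => ?_
    rw [mul_left_comm, ← prod_mul_distrib]
    congr 1
    exact prod_congr rfl fun j _ => by ring
  -- Replacing `p` by `p ∘ σ` changes the minor only by `sign σ`; summing over `σ` then rebuilds a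
  -- second copy of the minor.
  have h2 : ∀ σ : Equiv.Perm k, (Vᵀ * diagonal w * V).det =
      ∑ p : k → m, (∏ j, w (p j)) * (V.submatrix p id).det *
        (((Equiv.Perm.sign σ : ℤ) : ℝ) * ∏ j, V (p (σ j)) j) := by
    intro σ
    rw [h1, ← Equiv.sum_comp (Equiv.arrowCongr σ.symm (Equiv.refl m)).symm.symm]
    refine sum_congr rfl fun p _ => ?_
    have e1 : (V.submatrix (p ∘ σ) id).det =
        ((Equiv.Perm.sign σ : ℤ) : ℝ) * (V.submatrix p id).det :=
      det_permute σ (V.submatrix p id)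
    have e2 : (Equiv.arrowCongr σ.symm (Equiv.refl m)) p = p ∘ σ := by
      funext j; simp
    simp only [Equiv.symm_symm]
    rw [e2, e1, prod_mul_distrib]
    have e3 : ∏ j, w ((p ∘ σ) j) = ∏ j, w (p j) := Equiv.prod_comp σ fun j => w (p j)
    rw [e3]
    simp only [Function.comp_apply]
    ring
  have h3 := sum_congr (rfl : (univ : Finset (Equiv.Perm k)) = univ) fun σ _ => h2 σ
  rw [sum_const, card_univ, Fintype.card_perm, nsmul_eq_mul, sum_comm] at h3
  rw [h3]
  refine sum_congr rfl fun p _ => ?_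
  rw [← mul_sum, sq, mul_assoc]
  congr 2
  rw [det_apply']
  rfl

/-- Hölder with exponents `1 / a` and `1 / b`. -/
theorem Finset.sum_mul_exp_le_rpow {ι : Type*} (s : Finset ι) {c u v : ι → ℝ}
    (hc : ∀ i ∈ s, 0 ≤ c i) {a b : ℝ} (ha : 0 < a) (hb : 0 < b) (hab : a + b = 1) :
    ∑ i ∈ s, c i * Real.exp (a * u i + b * v i) ≤
      (∑ i ∈ s, c i * Real.exp (u i)) ^ a * (∑ i ∈ s, c i * Real.exp (v i)) ^ b := by
  have hpq : (1 / a).HolderConjugate (1 / b) := by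
    rw [Real.holderConjugate_iff]
    refine ⟨?_, by simpa using hab⟩
    rw [lt_div_iff₀ ha]; linarith
  have h0 : ∀ w : ι → ℝ, ∀ i ∈ s, 0 ≤ c i * Real.exp (w i) := fun w i hi =>
    mul_nonneg (hc i hi) (Real.exp_pos _).le
  have := Real.inner_le_Lp_mul_Lq_of_nonneg s hpq (f := fun i => (c i * Real.exp (u i)) ^ a)
    (g := fun i => (c i * Real.exp (v i)) ^ b) (fun i hi => Real.rpow_nonneg (h0 u i hi) _)
    (fun i hi => Real.rpow_nonneg (h0 v i hi) _)
  simp only [one_div_one_div] at this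
  convert this using 1
  · refine Finset.sum_congr rfl fun i hi => ?_
    rw [Real.mul_rpow (hc i hi) (Real.exp_pos _).le, Real.mul_rpow (hc i hi) (Real.exp_pos _).le,
      mul_mul_mul_comm, ← Real.exp_mul, ← Real.exp_mul, ← Real.exp_add, mul_comm (u i),
      mul_comm (v i), ← Real.rpow_add_of_nonneg (hc i hi) ha.le hb.le, hab, Real.rpow_one]
  · congr 2 <;> refine Finset.sum_congr rfl fun i hi => ?_
    · rw [one_div, Real.rpow_rpow_inv (h0 u i hi) ha.ne']
    · rw [one_div, Real.rpow_rpow_inv (h0 v i hi) hb.ne']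

open Matrix in
/-- The function `z ↦ det (Vᵀ diag (e ^ z) V)` is log-convex. -/
theorem Matrix.det_transpose_mul_diagonal_exp_mul_le {m k : Type*} [Fintype m] [DecidableEq m]
    [Fintype k] [DecidableEq k] (V : Matrix m k ℝ) (u v : m → ℝ) {a b : ℝ} (ha : 0 < a)
    (hb : 0 < b) (hab : a + b = 1) :
    (Vᵀ * diagonal (fun i => Real.exp ((a • u + b • v) i)) * V).det ≤
      (Vᵀ * diagonal (fun i => Real.exp (u i)) * V).det ^ a *
        (Vᵀ * diagonal (fun i => Real.exp (v i)) * V).det ^ b := by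
  have hdet : ∀ z : m → ℝ, (Vᵀ * diagonal (fun i => Real.exp (z i)) * V).det =
      ∑ p : k → m, ((V.submatrix p id).det ^ 2 / (Fintype.card k).factorial) *
        Real.exp (∑ j, z (p j)) := by
    intro z
    have h := factorial_mul_det_transpose_mul_diagonal_mul V fun i => Real.exp (z i)
    have h0 : ((Fintype.card k).factorial : ℝ) ≠ 0 := by positivity
    rw [← mul_right_inj' h0, h, Finset.mul_sum]
    refine Finset.sum_congr rfl fun p _ => ?_
    rw [Real.exp_sum]
    field_simp
  rw [hdet, hdet, hdet]
  refine le_trans (le_of_eq ?_) (Finset.sum_mul_exp_le_rpow _ (fun p _ => by positivity) ha hb hab)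
  refine Finset.sum_congr rfl fun p _ => ?_
  simp [Finset.sum_add_distrib, Finset.mul_sum]

/-! ### Gaussian and exponential integrals in coordinates on the subspace. -/

open Matrix in
theorem Matrix.PosDef.exists_eq_transpose_mul_self {k : Type*} [Fintype k] [DecidableEq k]
    {A : Matrix k k ℝ} (hA : A.PosDef) : ∃ B : Matrix k k ℝ, A = Bᵀ * B := by
  open scoped MatrixOrder in
  obtain ⟨B, hB⟩ := CStarAlgebra.nonneg_iff_eq_star_mul_self.mp hA.posSemidef.nonneg
  exact ⟨B, hB⟩

open Matrix in
/-- The Gaussian integral of a positive definite quadratic form. -/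
theorem Matrix.PosDef.lintegral_exp_neg {k : Type*} [Fintype k] [DecidableEq k]
    (μ : Measure (k → ℝ)) [μ.IsAddHaarMeasure] {A : Matrix k k ℝ} (hA : A.PosDef) :
    ∫⁻ x, ENNReal.ofReal (Real.exp (-(x ⬝ᵥ A *ᵥ x))) ∂μ =
      ENNReal.ofReal (A.det ^ (-(1 / 2) : ℝ)) *
        ∫⁻ x, ENNReal.ofReal (Real.exp (-(x ⬝ᵥ x))) ∂μ := by
  obtain ⟨B, rfl⟩ := hA.exists_eq_transpose_mul_self
  have hd : (Bᵀ * B).det = B.det ^ 2 := by rw [det_mul, det_transpose, sq]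
  have hpos := hA.det_pos
  have hB : LinearMap.det (toLin' B) ≠ 0 := by
    rw [LinearMap.det_toLin']
    rintro h
    simp [hd, h] at hpos
  have hm : Measurable fun x : k → ℝ => ENNReal.ofReal (Real.exp (-(x ⬝ᵥ x))) := by
    unfold dotProduct; fun_prop
  -- Substituting `y = B x` in the integral scales any Haar measure by `|det B|⁻¹`.
  have h := lintegral_map (μ := μ) hm
    (LinearMap.continuous_of_finiteDimensional (toLin' B)).measurable
  rw [Measure.map_linearMap_addHaar_eq_smul_addHaar μ hB, lintegral_smul_measure,
    LinearMap.det_toLin', smul_eq_mul] at h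
  have e : (Bᵀ * B).det ^ (-(1 / 2) : ℝ) = |B.det⁻¹| := by
    rw [hd, Real.rpow_neg (sq_nonneg _), ← Real.sqrt_eq_rpow, Real.sqrt_sq_eq_abs, abs_inv]
  rw [e, h]
  refine lintegral_congr fun x => ?_
  rw [toLin'_apply, ← mulVec_mulVec, dotProduct_mulVec, vecMul_transpose]

-- The power `-1/2` turns log-convexity of the determinant into log-concavity of the Gaussian
-- integral.
open Matrix in
theorem Matrix.lintegral_exp_neg_sum_exp_mul_sq_rpow_mul_le {m k : Type*} [Fintype m]
    [Fintype k] (μ : Measure (k → ℝ)) [μ.IsAddHaarMeasure] {V : Matrix m k ℝ}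
    (hV : Function.Injective V.mulVec) (u v : m → ℝ) {a b : ℝ} (ha : 0 < a) (hb : 0 < b)
    (hab : a + b = 1) :
    (∫⁻ x, ENNReal.ofReal (Real.exp (-∑ i, Real.exp (u i) * (V *ᵥ x) i ^ 2)) ∂μ) ^ a *
      (∫⁻ x, ENNReal.ofReal (Real.exp (-∑ i, Real.exp (v i) * (V *ᵥ x) i ^ 2)) ∂μ) ^ b ≤
      ∫⁻ x, ENNReal.ofReal (Real.exp (-∑ i, Real.exp ((a • u + b • v) i) * (V *ᵥ x) i ^ 2)) ∂μ := by
  classical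
  have hpd : ∀ z : m → ℝ, (Vᵀ * diagonal (fun i => Real.exp (z i)) * V).PosDef := fun z =>
    (PosDef.diagonal fun i => Real.exp_pos (z i)).conjTranspose_mul_mul_same hV
  have hq : ∀ (z : m → ℝ) (x : k → ℝ), ∑ i, Real.exp (z i) * (V *ᵥ x) i ^ 2 =
      x ⬝ᵥ (Vᵀ * diagonal (fun i => Real.exp (z i)) * V) *ᵥ x := by
    intro z x
    rw [Matrix.mul_assoc, ← mulVec_mulVec, ← mulVec_mulVec, dotProduct_mulVec, vecMul_transpose]
    refine Finset.sum_congr rfl fun i _ => ?_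
    rw [mulVec_diagonal]
    ring
  simp only [hq, (hpd _).lintegral_exp_neg μ]
  set c := ∫⁻ x, ENNReal.ofReal (Real.exp (-(x ⬝ᵥ x))) ∂μ
  rw [ENNReal.mul_rpow_of_nonneg _ _ ha.le, ENNReal.mul_rpow_of_nonneg _ _ hb.le,
    mul_mul_mul_comm, ← ENNReal.rpow_add_of_nonneg _ _ ha.le hb.le, hab, ENNReal.rpow_one]
  gcongr
  have hp := fun z => (hpd z).det_pos
  rw [ENNReal.ofReal_rpow_of_pos (Real.rpow_pos_of_pos (hp u) _),
    ENNReal.ofReal_rpow_of_pos (Real.rpow_pos_of_pos (hp v) _),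
    ← ENNReal.ofReal_mul (Real.rpow_nonneg (Real.rpow_nonneg (hp u).le _) _)]
  refine ENNReal.ofReal_le_ofReal ?_
  rw [← Real.rpow_mul (hp u).le, ← Real.rpow_mul (hp v).le, mul_comm _ a, mul_comm _ b,
    Real.rpow_mul (hp u).le, Real.rpow_mul (hp v).le,
    ← Real.mul_rpow (Real.rpow_nonneg (hp u).le _) (Real.rpow_nonneg (hp v).le _)]
  exact Real.rpow_le_rpow_of_nonpos (hp _)
    (det_transpose_mul_diagonal_exp_mul_le V u v ha hb hab) (by norm_num)

-- The mixture formula in each coordinate, followed by Tonelli. The term `-log 2` moves the factor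
-- `1/2` of the Gaussian into the exponent, so that the coefficients are pure exponentials.
open Matrix in
theorem Matrix.lintegral_exp_neg_sum_exp_mul_abs_eq {m k : Type*} [Fintype m] [Fintype k]
    (μ : Measure (k → ℝ)) [SFinite μ] (V : Matrix m k ℝ) (t : m → ℝ) :
    ENNReal.ofReal √(Real.pi / 2) ^ Fintype.card m *
      ∫⁻ x, ENNReal.ofReal (Real.exp (-∑ i, Real.exp (-t i) * |(V *ᵥ x) i|)) ∂μ =
      ∫⁻ y : m → ℝ, ENNReal.ofReal (Real.exp (∑ i, (y i - Real.exp (2 * y i) / 2))) *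
        ∫⁻ x, ENNReal.ofReal (Real.exp (-∑ i, Real.exp (-(2 * (y i + t i)) - Real.log 2) *
          (V *ᵥ x) i ^ 2)) ∂μ := by
  have hVm : ∀ i, Measurable fun x : k → ℝ => (V *ᵥ x) i := by
    intro i
    unfold mulVec dotProduct
    fun_prop
  have hprod : ∀ c : m → ℝ, ENNReal.ofReal (Real.exp (∑ i, c i)) =
      ∏ i, ENNReal.ofReal (Real.exp (c i)) := by
    intro c
    rw [Real.exp_sum, ENNReal.ofReal_prod_of_nonneg fun i _ => (Real.exp_pos _).le]
  have h1 : ∀ x : k → ℝ, ENNReal.ofReal √(Real.pi / 2) ^ Fintype.card m *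
      ENNReal.ofReal (Real.exp (-∑ i, Real.exp (-t i) * |(V *ᵥ x) i|)) =
      ∫⁻ y : m → ℝ, ENNReal.ofReal (Real.exp (∑ i, (y i - Real.exp (2 * y i) / 2))) *
        ENNReal.ofReal (Real.exp (-∑ i, Real.exp (-(2 * (y i + t i)) - Real.log 2) *
          (V *ᵥ x) i ^ 2)) := by
    intro x
    simp only [← Finset.sum_neg_distrib, hprod, ← Finset.prod_mul_distrib]
    rw [lintegral_pi_prod_eq_prod (φ := fun i v =>
      ENNReal.ofReal (Real.exp (v - Real.exp (2 * v) / 2)) *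
        ENNReal.ofReal (Real.exp (-(Real.exp (-(2 * (v + t i)) - Real.log 2) * (V *ᵥ x) i ^ 2))))
      (fun i => by fun_prop), ← Finset.card_univ, ← Finset.prod_const, ← Finset.prod_mul_distrib]
    refine Finset.prod_congr rfl fun i _ => ?_
    have := lintegral_exp_sub_mul_exp_neg_sq (Real.exp (-t i) * (V *ᵥ x) i)
    rw [abs_mul, abs_of_pos (Real.exp_pos _)] at this
    rw [← this]
    refine lintegral_congr fun v => ?_
    congr 4
    rw [Real.exp_sub, Real.exp_log two_pos, mul_pow, ← Real.exp_nat_mul,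
      show -(2 * (v + t i)) = -(2 * v) + (2 : ℕ) * -t i by push_cast; ring, Real.exp_add]
    ring
  rw [← lintegral_const_mul _ (by fun_prop)]
  simp only [h1]
  rw [lintegral_lintegral_swap]
  · refine lintegral_congr fun y => ?_
    rw [lintegral_const_mul _ (by fun_prop)]
  · refine Measurable.aemeasurable ?_
    unfold Function.uncurry
    have : ∀ i, Measurable fun p : (k → ℝ) × (m → ℝ) => (V *ᵥ p.1) i := fun i =>
      (hVm i).comp measurable_fst
    fun_prop

open Matrix in
theorem Matrix.lintegral_exp_neg_sum_exp_mul_abs_rpow_mul_le {m k : Type*} [Fintype m]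
    [Fintype k] (μ : Measure (k → ℝ)) [μ.IsAddHaarMeasure] {V : Matrix m k ℝ}
    (hV : Function.Injective V.mulVec) (s t : m → ℝ) {a b : ℝ} (ha : 0 < a) (hb : 0 < b)
    (hab : a + b = 1) :
    (∫⁻ x, ENNReal.ofReal (Real.exp (-∑ i, Real.exp (-s i) * |(V *ᵥ x) i|)) ∂μ) ^ a *
      (∫⁻ x, ENNReal.ofReal (Real.exp (-∑ i, Real.exp (-t i) * |(V *ᵥ x) i|)) ∂μ) ^ b ≤
      ∫⁻ x, ENNReal.ofReal (Real.exp (-∑ i, Real.exp (-(a • s + b • t) i) * |(V *ᵥ x) i|)) ∂μ := by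
  set C := ENNReal.ofReal √(Real.pi / 2) ^ Fintype.card m with hC
  have hC0 : C ≠ 0 := pow_ne_zero _ (by
    rw [Ne, ENNReal.ofReal_eq_zero, not_le]; exact Real.sqrt_pos.2 (by positivity))
  have hCt : C ≠ ⊤ := ENNReal.pow_ne_top ENNReal.ofReal_ne_top
  rw [← ENNReal.mul_le_mul_iff_right hC0 hCt]
  nth_rewrite 1 [← ENNReal.rpow_one C, ← hab]
  rw [ENNReal.rpow_add_of_nonneg _ _ ha.le hb.le, mul_mul_mul_comm,
    ← ENNReal.mul_rpow_of_nonneg _ _ ha.le, ← ENNReal.mul_rpow_of_nonneg _ _ hb.le, hC,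
    lintegral_exp_neg_sum_exp_mul_abs_eq, lintegral_exp_neg_sum_exp_mul_abs_eq,
    lintegral_exp_neg_sum_exp_mul_abs_eq]
  have hVm : ∀ i, Measurable fun p : (m → ℝ) × (k → ℝ) => (V *ᵥ p.2) i := by
    intro i
    unfold mulVec dotProduct
    fun_prop
  have hmeas : ∀ t : m → ℝ, Measurable fun y : m → ℝ =>
      ENNReal.ofReal (Real.exp (∑ i, (y i - Real.exp (2 * y i) / 2))) *
        ∫⁻ x, ENNReal.ofReal (Real.exp (-∑ i, Real.exp (-(2 * (y i + t i)) - Real.log 2) *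
          (V *ᵥ x) i ^ 2)) ∂μ := by
    intro t
    refine Measurable.mul (by fun_prop) (Measurable.lintegral_prod_right ?_)
    fun_prop
  -- Joint log-concavity in `(y, t)`: the weight contributes by convexity of `exp`, the Gaussian
  -- integral because its exponents are affine in `y + t`.
  refine lintegral_pi_rpow_mul_le (hmeas s) (hmeas t) (hmeas _) ha hb hab fun x y => ?_
  rw [ENNReal.mul_rpow_of_nonneg _ _ ha.le, ENNReal.mul_rpow_of_nonneg _ _ hb.le,
    mul_mul_mul_comm]
  refine mul_le_mul' ?_ ?_
  · rw [ENNReal.ofReal_rpow_of_pos (Real.exp_pos _), ENNReal.ofReal_rpow_of_pos (Real.exp_pos _),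
      ← ENNReal.ofReal_mul (by positivity), ← Real.exp_mul, ← Real.exp_mul, ← Real.exp_add]
    refine ENNReal.ofReal_le_ofReal (Real.exp_le_exp.2 ?_)
    rw [Finset.sum_mul, Finset.sum_mul, ← Finset.sum_add_distrib]
    refine Finset.sum_le_sum fun i _ => ?_
    have := convexOn_exp.2 (Set.mem_univ (2 * x i)) (Set.mem_univ (2 * y i)) ha.le hb.le hab
    simp only [smul_eq_mul, Pi.add_apply, Pi.smul_apply] at this ⊢
    rw [show 2 * (a * x i + b * y i) = a * (2 * x i) + b * (2 * y i) by ring]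
    linarith
  · refine (lintegral_exp_neg_sum_exp_mul_sq_rpow_mul_le μ hV
      (fun i => -(2 * (x i + s i)) - Real.log 2) (fun i => -(2 * (y i + t i)) - Real.log 2)
      ha hb hab).trans_eq ?_
    refine lintegral_congr fun w => ?_
    congr 3
    refine Finset.sum_congr rfl fun i _ => ?_
    congr 2
    simp only [smul_eq_mul, Pi.add_apply, Pi.smul_apply]
    linear_combination (-Real.log 2) * hab

/-! ### From exponential integrals to volumes of sections. -/

-- Injectivity of `V` and positivity of `c` make the weighted sum a norm, so integrating `exp (-g)`
-- gives a Gamma factor times the volume of the unit ball.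
open Matrix in
theorem Matrix.measure_sum_mul_abs_le_one {m k : Type*} [Fintype m] [Fintype k]
    (μ : Measure (k → ℝ)) [μ.IsAddHaarMeasure] {V : Matrix m k ℝ}
    (hV : Function.Injective V.mulVec) {c : m → ℝ} (hc : ∀ i, 0 < c i) :
    μ {x | ∑ i, c i * |(V *ᵥ x) i| ≤ 1} < ⊤ ∧
    ENNReal.ofReal (Real.Gamma (Fintype.card k + 1)) * μ {x | ∑ i, c i * |(V *ᵥ x) i| ≤ 1} =
      ∫⁻ x, ENNReal.ofReal (Real.exp (-∑ i, c i * |(V *ᵥ x) i|)) ∂μ := by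
  set g : (k → ℝ) → ℝ := fun x => ∑ i, c i * |(V *ᵥ x) i| with hg
  have g0 : g 0 = 0 := by simp [hg]
  have gneg : ∀ x, g (-x) = g x := fun x => by simp [hg, mulVec_neg]
  have gadd : ∀ x y, g (x + y) ≤ g x + g y := fun x y => by
    simp only [hg, mulVec_add, Pi.add_apply, ← Finset.sum_add_distrib, ← mul_add]
    exact Finset.sum_le_sum fun i _ => mul_le_mul_of_nonneg_left (abs_add_le _ _) (hc i).le
  have gnn : ∀ x, ∀ i ∈ Finset.univ, 0 ≤ c i * |(V *ᵥ x) i| := fun x i _ =>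
    mul_nonneg (hc i).le (abs_nonneg _)
  have geq : ∀ {x}, g x = 0 → x = 0 := fun {x} hx => by
    have := (Finset.sum_eq_zero_iff_of_nonneg (gnn x)).1 hx
    refine hV ?_
    rw [mulVec_zero]
    ext i
    simpa [(hc i).ne'] using this i (Finset.mem_univ i)
  have gsmul : ∀ (r : ℝ) x, g (r • x) ≤ |r| * g x := fun r x => by
    simp only [hg, mulVec_smul, Pi.smul_apply, smul_eq_mul, abs_mul, Finset.mul_sum]
    exact Finset.sum_le_sum fun i _ => (mul_left_comm _ _ _).le
  have gcont : Continuous g := by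
    have : ∀ i, Continuous fun x : k → ℝ => (V *ᵥ x) i := fun i => by
      unfold mulVec dotProduct; fun_prop
    fun_prop
  have hle : μ {x | g x ≤ 1} = μ {x | g x < 1} := by
    -- In dimension 0 both balls are the whole space; otherwise the unit sphere is null.
    rcases subsingleton_or_nontrivial (k → ℝ) with hE | hE
    · congr 1
      ext x
      simp [Subsingleton.elim x 0, g0]
    · exact measure_le_eq_lt μ g0 gneg gadd geq gsmul 1
  have hlt := measure_lt_one_eq_integral_div_gamma μ g0 gneg gadd geq gsmul one_pos
  have hpos : μ {x | g x < 1} ≠ 0 :=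
    ((isOpen_lt gcont continuous_const).measure_pos μ ⟨0, by simp [g0]⟩).ne'
  simp only [Real.rpow_one, Module.finrank_fintype_fun_eq_card, div_one] at hlt
  have hint : Integrable (fun x => Real.exp (-g x)) μ := by
    -- Without integrability the Bochner integral is 0 by convention, which would make the open unit
    -- ball null.
    by_contra h
    rw [integral_undef h] at hlt
    simp [hlt] at hpos
  have hG : 0 < Real.Gamma (Fintype.card k + 1) := Real.Gamma_pos_of_pos (by positivity)
  refine ⟨by rw [hle, hlt]; exact ENNReal.ofReal_lt_top, ?_⟩
  rw [hle, hlt, ← ENNReal.ofReal_mul hG.le, mul_div_cancel₀ _ hG.ne',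
    ofReal_integral_eq_lintegral_ofReal hint (Filter.Eventually.of_forall fun x => (Real.exp_pos _).le)]

open Matrix in
theorem Matrix.measure_sum_exp_mul_abs_rpow_mul_le {m k : Type*} [Fintype m] [Fintype k]
    (μ : Measure (k → ℝ)) [μ.IsAddHaarMeasure] {V : Matrix m k ℝ}
    (hV : Function.Injective V.mulVec) (s t : m → ℝ) {a b : ℝ} (ha : 0 < a) (hb : 0 < b)
    (hab : a + b = 1) :
    μ {x | ∑ i, Real.exp (-s i) * |(V *ᵥ x) i| ≤ 1} ^ a *
      μ {x | ∑ i, Real.exp (-t i) * |(V *ᵥ x) i| ≤ 1} ^ b ≤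
      μ {x | ∑ i, Real.exp (-(a • s + b • t) i) * |(V *ᵥ x) i| ≤ 1} := by
  set G := ENNReal.ofReal (Real.Gamma (Fintype.card k + 1)) with hG
  have hG0 : G ≠ 0 := by
    rw [hG, Ne, ENNReal.ofReal_eq_zero, not_le]
    exact Real.Gamma_pos_of_pos (by positivity)
  have hGt : G ≠ ⊤ := ENNReal.ofReal_ne_top
  have h := fun t : m → ℝ => (measure_sum_mul_abs_le_one μ hV fun i => Real.exp_pos (-t i)).2
  rw [← ENNReal.mul_le_mul_iff_right hG0 hGt]
  nth_rewrite 1 [← ENNReal.rpow_one G, ← hab]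
  rw [ENNReal.rpow_add_of_nonneg _ _ ha.le hb.le, mul_mul_mul_comm,
    ← ENNReal.mul_rpow_of_nonneg _ _ ha.le, ← ENNReal.mul_rpow_of_nonneg _ _ hb.le, hG, h, h, h]
  exact lintegral_exp_neg_sum_exp_mul_abs_rpow_mul_le μ hV s t ha hb hab

theorem mem_expDilation_crossPolytope {n : ℕ} (t : Fin n → ℝ) (x : EuclideanSpace ℝ (Fin n)) :
    x ∈ expDilation t (crossPolytope n) ↔ ∑ i, Real.exp (-t i) * |x i| ≤ 1 := by
  have happ : ∀ (c : Fin n → ℝ) (y : EuclideanSpace ℝ (Fin n)) i,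
      Matrix.toEuclideanLin (Matrix.diagonal c) y i = c i * y i := fun c y i => by
    simp [Matrix.toLpLin_apply, Matrix.mulVec_diagonal]
  constructor
  · rintro ⟨y, hy, rfl⟩
    refine le_of_eq_of_le (Finset.sum_congr rfl fun i _ => ?_) hy
    rw [happ, abs_mul, abs_of_pos (Real.exp_pos _), ← mul_assoc, ← Real.exp_add, neg_add_cancel,
      Real.exp_zero, one_mul]
  · intro hx
    refine ⟨Matrix.toEuclideanLin (Matrix.diagonal fun i => Real.exp (-t i)) x, ?_, ?_⟩
    · refine le_of_eq_of_le (Finset.sum_congr rfl fun i _ => ?_) hx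
      rw [happ, abs_mul, abs_of_pos (Real.exp_pos _)]
    · ext i
      rw [happ, happ, ← mul_assoc, ← Real.exp_add, add_neg_cancel, Real.exp_zero, one_mul]

-- Any basis of `H` will do, orthonormal or not: the inequality needs only a Haar measure, and
-- pushing forward along a linear isomorphism preserves this.
open Matrix in
theorem exists_addHaar_subspaceVolume_expDilation_eq {n : ℕ}
    (H : Submodule ℝ (EuclideanSpace ℝ (Fin n))) :
    ∃ (k : ℕ) (V : Matrix (Fin n) (Fin k) ℝ) (μ : Measure (Fin k → ℝ)),
      μ.IsAddHaarMeasure ∧ Function.Injective V.mulVec ∧ ∀ t : Fin n → ℝ,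
        subspaceVolume H (expDilation t (crossPolytope n) ∩ (H : Set (EuclideanSpace ℝ (Fin n)))) =
          μ {x | ∑ i, Real.exp (-t i) * |(V *ᵥ x) i| ≤ 1} := by
  let ν : Measure H := @volume H measureSpaceOfInnerProductSpace
  have hν : ν.IsAddHaarMeasure := by
    unfold ν
    infer_instance
  let e : H ≃L[ℝ] (Fin (Module.finrank ℝ H) → ℝ) := (Module.finBasis ℝ H).equivFunL
  let L : (Fin (Module.finrank ℝ H) → ℝ) →ₗ[ℝ] (Fin n → ℝ) :=
    (WithLp.linearEquiv 2 ℝ (Fin n → ℝ)).toLinearMap ∘ₗ H.subtype ∘ₗ e.symm.toLinearMap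
  have hL : ∀ x, LinearMap.toMatrix' L *ᵥ x = L x := fun x => LinearMap.toMatrix'_mulVec L x
  have hLe : ∀ (x : H) i, L (e x) i = (x : EuclideanSpace ℝ (Fin n)) i := fun x i => by simp [L]
  refine ⟨_, LinearMap.toMatrix' L, ν.map e, e.isAddHaarMeasure_map ν, ?_, fun t => ?_⟩
  · intro x y hxy
    rw [hL, hL] at hxy
    apply e.symm.injective
    ext i
    have := congrFun hxy i
    rw [← e.apply_symm_apply x, ← e.apply_symm_apply y, hLe, hLe] at this
    exact this
  · have hemb : MeasurableEmbedding (Subtype.val : H → EuclideanSpace ℝ (Fin n)) :=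
      MeasurableEmbedding.subtype_coe H.closed_of_finiteDimensional.measurableSet
    change Measure.map Subtype.val ν _ = Measure.map e.toHomeomorph ν _
    rw [hemb.map_apply, e.toHomeomorph.measurableEmbedding.map_apply]
    congr 1
    ext x
    simp only [Set.mem_preimage, Set.mem_inter_iff, SetLike.mem_coe, x.2, and_true, hL,
      mem_expDilation_crossPolytope, Set.mem_ofPred_eq]
    simp only [ContinuousLinearEquiv.coe_toHomeomorph, hLe]

theorem theorem1 (n : ℕ) (H : Submodule ℝ (EuclideanSpace ℝ (Fin n))) :
    (∀ t : Fin n → ℝ,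
      subspaceVolume H (expDilation t (crossPolytope n) ∩ (H : Set (EuclideanSpace ℝ (Fin n)))) < ⊤) ∧
    IsLogConcave (fun t : Fin n → ℝ =>
      (subspaceVolume H (expDilation t (crossPolytope n) ∩
        (H : Set (EuclideanSpace ℝ (Fin n))))).toReal) := by
  obtain ⟨k, V, μ, hμ, hV, h⟩ := exists_addHaar_subspaceVolume_expDilation_eq H
  simp only [h]
  have hfin := fun t : Fin n → ℝ =>
    (Matrix.measure_sum_mul_abs_le_one μ hV fun i => Real.exp_pos (-t i)).1
  refine ⟨hfin, fun t => ENNReal.toReal_nonneg, fun s t a b ha hb hab => ?_⟩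
  -- Prékopa-Leindler and Hölder were used with positive weights; the endpoint weights are trivial
  -- since `x ^ 0 = 1`.
  rcases ha.eq_or_lt with rfl | ha
  · obtain rfl : b = 1 := by linarith
    simp
  rcases hb.eq_or_lt with rfl | hb
  · obtain rfl : a = 1 := by linarith
    simp
  rw [ENNReal.toReal_rpow, ENNReal.toReal_rpow, ← ENNReal.toReal_mul]
  exact ENNReal.toReal_mono (hfin _).ne
    (Matrix.measure_sum_exp_mul_abs_rpow_mul_le μ hV s t ha hb hab)
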